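/- Let $A$ be a discrete valuation ring with uniformizing parameter $\tau$, let $R=A[x_1,\dots,x_n]$, let $I\subset R$ be an ideal, and put $B=R/I$, $Y=\operatorname{Spec} B$, $T=\operatorname{Spec} A$. For a prime $P$ of $B$ lying over the prime $\mathfrak p=P\cap A$ of $A$, the dimension of the closed subset $V(P)\subset Y$, as a scheme of finite type over $T$, means $$\dim (A/\mathfrak p)+\operatorname{trdeg}_{\kappa(\mathfrak p)}\kappa(P),$$ and $Y$ is called equidimensional if all its irreducible components (the sets $V(P)$ with $P$ a minimal prime of $B$) have the same dimension in this sense. (For a component that meets the closed fiber of $Y\to T$ this is the Krull dimension of $B/P$.) An embedded prime of $B$ is an associated prime of $B$ that is not minimal; $Y$ has no embedded components if $B$ has no embedded primes; and $Y\to T$ is internally flat if each embedded prime of $B$ contracts to $0$ in $A$. Suppose that $Y$ is equidimensional, and let $J\subset I$ be an ideal generated by a regular sequence in $R$ whose length is the height of $I$. Then: 1. $Y$ has no embedded components $\iff J:(J:I)\subset I$; 2. $Y\to T$ is flat $\iff I:\tau\subset I$; 3. $Y\to T$ is internally flat $\iff (I:\tau)\cap (J:(J:I))\subset I$. -/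

import Mathlib

/-- The embedded primes of a ring `B`: the associated primes of `B` that are not minimal. -/
def embeddedPrimes (B : Type*) [CommRing B] : Set (Ideal B) :=
  associatedPrimes B B \ minimalPrimes B

/-- The affine scheme `Spec B` has no embedded components. -/
def HasNoEmbeddedComponents (B : Type*) [CommRing B] : Prop :=
  embeddedPrimes B = ∅

/-- The morphism `Spec B → Spec A` is internally flat: each embedded prime of `B`
contracts to zero in `A`. -/
def IsInternallyFlat (A B : Type*) [CommRing A] [CommRing B] [Algebra A B] : Prop :=
  ∀ P ∈ embeddedPrimes B, P.comap (algebraMap A B) = ⊥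

/-- The dimension of the closed subset `V = V(P)` of `Spec B`, for a prime `P`, where `Spec B` is
regarded as a scheme of finite type over the base `Spec A`: the dimension of the closure of the
image of `V` in `Spec A` (that is, of `Spec (A ⧸ 𝔭)`, where `𝔭 = P ∩ A`), plus the transcendence
degree of the function field of `V` over the residue field of `𝔭` (that is, of the domain `B ⧸ P`
over the domain `A ⧸ 𝔭`). -/
noncomputable def componentDim (A : Type*) {B : Type*} [CommRing A] [CommRing B] [Algebra A B]
    (P : Ideal B) : WithBot ℕ∞ :=
  ringKrullDim (A ⧸ P.under A) +
    ((Cardinal.toENat (Algebra.trdeg (A ⧸ P.under A) (B ⧸ P)) : ℕ∞) : WithBot ℕ∞)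

/-- `Spec B` is equidimensional as a scheme over `Spec A`: all its irreducible components have the
same dimension. -/
def IsEquidimensionalOver (A B : Type*) [CommRing A] [CommRing B] [Algebra A B] : Prop :=
  ∀ P ∈ minimalPrimes B, ∀ Q ∈ minimalPrimes B, componentDim A P = componentDim A Q

/-!
Put `U = J : (J : I)`. The embedded primes of `R ⧸ I` are exactly the associated primes of `U ⧸ I`.
Indeed the associated primes of `R ⧸ U` are associated to `R ⧸ J`, hence have height equal to the
length of the regular sequence because the regular ring `R` is Cohen-Macaulay; as they contain `I`,
they are minimal over `I`. Conversely, at a minimal prime `P` of `I` the ring `R_P ⧸ J_P` is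
Artinian and Gorenstein, so every ideal of it is its own double annihilator and `U_P = I_P`. Now (1)
says that `U ⧸ I` vanishes and (3) that `τ` is a nonzerodivisor on it, while (2) says that `τ` is a
nonzerodivisor on `R ⧸ I`.

The Gorenstein property comes from comparing socles: for a regular sequence `rs` in the maximal
ideal of a local ring, the socle of `R ⧸ rs` depends only on the length of `rs`, and for a regular
system of parameters it is the residue field. Equidimensionality forces all minimal primes of `I` to
have the same height through the dimension formula for polynomial rings.
-/

open IsLocalRing RingTheory.Sequence
open scoped Pointwise

section Socle

variable {R : Type*} [CommRing R]

theorem nonempty_torsionBySet_linearEquiv_of_injective {M N : Type*} [AddCommGroup M] [Module R M]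
    [AddCommGroup N] [Module R N] {s : Set R} (f : M →ₗ[R] N) (hf : Function.Injective f)
    (h : Submodule.torsionBySet R N s ≤ LinearMap.range f) :
    Nonempty (Submodule.torsionBySet R M s ≃ₗ[R] Submodule.torsionBySet R N s) := by
  have hmem (x : M) :
      f x ∈ Submodule.torsionBySet R N s ↔ x ∈ Submodule.torsionBySet R M s := by
    simp only [Submodule.mem_torsionBySet_iff, ← map_smul, map_eq_zero_iff f hf]
  refine ⟨.ofBijective (f.restrict fun x hx ↦ (hmem x).2 hx) ⟨fun x y hxy ↦ ?_, ?_⟩⟩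
  · exact Subtype.ext (hf (congrArg Subtype.val hxy))
  · rintro ⟨y, hy⟩
    obtain ⟨x, rfl⟩ := h hy
    exact ⟨⟨x, (hmem x).1 hy⟩, rfl⟩

theorem nonempty_torsionBySet_linearEquiv {M N : Type*} [AddCommGroup M] [Module R M]
    [AddCommGroup N] [Module R N] (s : Set R) (e : M ≃ₗ[R] N) :
    Nonempty (Submodule.torsionBySet R M s ≃ₗ[R] Submodule.torsionBySet R N s) :=
  nonempty_torsionBySet_linearEquiv_of_injective e.toLinearMap e.injective
    (e.range.symm ▸ le_top)

/-- Evaluation at `1` identifies the homomorphisms out of the cyclic module `R ⧸ I` with the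
elements killed by `I`. -/
noncomputable def quotientHomEquivTorsionBySet (I : Ideal R) (M : Type*) [AddCommGroup M]
    [Module R M] : ((R ⧸ I) →ₗ[R] M) ≃ₗ[R] Submodule.torsionBySet R M (I : Set R) :=
  .ofBijective ((LinearMap.applyₗ (1 : R ⧸ I)).codRestrict _ fun f ↦ by
      rw [Submodule.mem_torsionBySet_iff]
      rintro ⟨a, ha⟩
      rw [LinearMap.applyₗ_apply_apply, ← map_smul, Algebra.smul_def, mul_one,
        Ideal.Quotient.algebraMap_eq, Ideal.Quotient.eq_zero_iff_mem.2 ha, map_zero])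
    ⟨fun f g hfg ↦ Submodule.linearMap_qext _ (LinearMap.ext_ring (congrArg Subtype.val hfg)),
      fun x ↦ ⟨I.liftQ (LinearMap.toSpanSingleton R M x) fun a ha ↦
        (Submodule.mem_torsionBySet_iff _ _).1 x.2 ⟨a, ha⟩, Subtype.ext (one_smul R (x : M))⟩⟩

variable {C : Type*} [AddCommGroup C] [Module R C]

theorem length_quotient_annihilator_le (N : Submodule R C) :
    Module.length R (R ⧸ N.annihilator) ≤ Module.length R (N →ₗ[R] C) := by
  have hker : LinearMap.ker (LinearMap.toSpanSingleton R (N →ₗ[R] C) N.subtype) =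
      N.annihilator := by
    ext r
    simp [Submodule.mem_annihilator, LinearMap.ext_iff]
  exact Module.length_le_of_injective (N.annihilator.liftQ _ hker.ge)
    (LinearMap.ker_eq_bot.1 (Submodule.ker_liftQ_eq_bot' _ _ hker.symm))

/-- The socle of a module over a local ring: the elements killed by the maximal ideal. -/
abbrev socle (R M : Type*) [CommRing R] [IsLocalRing R] [AddCommGroup M] [Module R M] :
    Submodule R M :=
  Submodule.torsionBySet R M (maximalIdeal R : Set R)

variable [IsLocalRing R]

theorem length_linearMap_eq_length_socle (S : Type*) [AddCommGroup S] [Module R S]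
    [IsSimpleModule R S] : Module.length R (S →ₗ[R] C) = Module.length R (socle R C) := by
  obtain ⟨𝔪, h𝔪, ⟨e⟩⟩ := isSimpleModule_iff_quot_maximal.1 ‹IsSimpleModule R S›
  obtain rfl := eq_maximalIdeal h𝔪
  exact ((e.congrLeft C R).trans (quotientHomEquivTorsionBySet _ C)).length_eq

theorem length_linearMap_le_mul_length_socle {M : Type*} [AddCommGroup M] [Module R M]
    (hM : IsFiniteLength R M) :
    Module.length R (M →ₗ[R] C) ≤ Module.length R M * Module.length R (socle R C) := by
  induction hM with
  | of_subsingleton => simp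
  | @of_simple_quotient M _ _ N _ _ ih =>
    have hexact : Function.Exact (LinearMap.lcomp R C N.mkQ) (LinearMap.lcomp R C N.subtype) :=
      LinearMap.exact_lcomp_of_exact_of_surjective C (LinearMap.exact_subtype_mkQ N)
        N.mkQ_surjective
    calc Module.length R (M →ₗ[R] C)
        ≤ Module.length R (M ⧸ N →ₗ[R] C) + Module.length R (N →ₗ[R] C) := by
          rw [Module.length_eq_add_of_exact (LinearMap.lcomp R C N.mkQ)
            (LinearMap.lcomp R C N.subtype).rangeRestrict
            (LinearMap.lcomp_injective_of_surjective _ N.mkQ_surjective)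
            (LinearMap.surjective_rangeRestrict _)
            (by rwa [LinearMap.exact_iff, LinearMap.ker_rangeRestrict, ← LinearMap.exact_iff])]
          gcongr
          exact Module.length_le_of_injective _ (Submodule.subtype_injective _)
      _ ≤ Module.length R (socle R C) + Module.length R N * Module.length R (socle R C) := by
          rw [length_linearMap_eq_length_socle]
          gcongr
      _ = Module.length R M * Module.length R (socle R C) := by
          rw [Module.length_eq_add_of_exact N.subtype N.mkQ N.subtype_injective
            N.mkQ_surjective (LinearMap.exact_subtype_mkQ N), Module.length_eq_one R (M ⧸ N),
            add_mul, one_mul, add_comm]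

theorem torsionBySet_annihilator_eq_of_length_socle_le_one (hC : IsFiniteLength R C)
    (hsocle : Module.length R (socle R C) ≤ 1) (N : Submodule R C) :
    Submodule.torsionBySet R C (N.annihilator : Set R) = N := by
  obtain ⟨_, _⟩ := isFiniteLength_iff_isNoetherian_isArtinian.1 hC
  have hN : IsFiniteLength R N :=
    isFiniteLength_iff_isNoetherian_isArtinian.2 ⟨inferInstance, inferInstance⟩
  have hquot : Module.length R (R ⧸ N.annihilator) ≤ Module.length R N :=
    (length_quotient_annihilator_le N).trans
      ((length_linearMap_le_mul_length_socle hN).trans (mul_le_of_le_one_right' hsocle))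
  have hlen : Module.length R (Submodule.torsionBySet R C (N.annihilator : Set R)) ≤
      Module.length R N := by
    refine le_trans ?_ hquot
    rw [← (quotientHomEquivTorsionBySet N.annihilator C).length_eq]
    exact (length_linearMap_le_mul_length_socle (Module.length_ne_top_iff.1
      (ne_top_of_le_ne_top (Module.length_ne_top_iff.2 hN) hquot))).trans
      (mul_le_of_le_one_right' hsocle)
  rw [Module.length_submodule, Module.length_submodule] at hlen
  have hle : N ≤ Submodule.torsionBySet R C (N.annihilator : Set R) := fun x hx ↦
    (Submodule.mem_torsionBySet_iff _ _).2 fun a ↦ Submodule.mem_annihilator.1 a.2 x hx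
  exact (hle.eq_of_not_lt fun hlt ↦ (Submodule.height_strictMono hlt).not_ge hlen).symm

theorem colon_colon_eq_of_length_socle_le_one {I J : Ideal R} (hJI : J ≤ I)
    (hJ : IsFiniteLength R (R ⧸ J)) (hsocle : Module.length R (socle R (R ⧸ J)) ≤ 1) :
    J.colon (J.colon (I : Set R) : Set R) = I := by
  ext x
  have hx : x ∈ J.colon (J.colon (I : Set R) : Set R) ↔
      J.mkQ x ∈ Submodule.torsionBySet R (R ⧸ J) ((Submodule.map J.mkQ I).annihilator : Set R) := by
    rw [Submodule.annihilator_map_mkQ_eq_colon, Submodule.mem_torsionBySet_iff,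
      Submodule.mem_colon]
    simp only [Subtype.forall, SetLike.mem_coe, Submodule.mkQ_apply, ← Submodule.Quotient.mk_smul,
      Submodule.Quotient.mk_eq_zero, smul_eq_mul, mul_comm x]
  rw [hx, torsionBySet_annihilator_eq_of_length_socle_le_one hJ hsocle, ← Submodule.mem_comap,
    Submodule.comap_map_mkQ, sup_eq_right.2 hJI]

end Socle

section RegularSequences

variable {R M : Type*} [CommRing R] [AddCommGroup M] [Module R M]

theorem nonempty_torsionBySet_quotSMulTop_mul {s : Set R} {a b : R} (has : a ∈ s)
    (ha : IsSMulRegular M a) (hb : IsSMulRegular M b) :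
    Nonempty (Submodule.torsionBySet R (QuotSMulTop a M) s ≃ₗ[R]
      Submodule.torsionBySet R (QuotSMulTop (a * b) M) s) := by
  have hle : a • (⊤ : Submodule R M) ≤
      ((a * b) • (⊤ : Submodule R M)).comap (LinearMap.lsmul R M b) := by
    rintro _ ⟨x, -, rfl⟩
    exact ⟨x, trivial, by simp [mul_smul, smul_comm a b]⟩
  refine nonempty_torsionBySet_linearEquiv_of_injective
    (Submodule.mapQ _ _ (LinearMap.lsmul R M b) hle) ?_ fun v hv ↦ ?_
  · rw [← LinearMap.ker_eq_bot, Submodule.ker_mapQ, Submodule.eq_bot_iff]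
    rintro _ ⟨x, ⟨y, -, hy⟩, rfl⟩
    refine (Submodule.Quotient.mk_eq_zero _).2 ⟨y, trivial, hb ?_⟩
    simpa [mul_smul, smul_comm a b] using hy
  · obtain ⟨x, rfl⟩ := Submodule.Quotient.mk_surjective _ v
    have h := (Submodule.mem_torsionBySet_iff _ _).1 hv ⟨a, has⟩
    rw [← Submodule.Quotient.mk_smul, Submodule.Quotient.mk_eq_zero] at h
    obtain ⟨y, -, hy⟩ := h
    refine ⟨Submodule.Quotient.mk y, congrArg Submodule.Quotient.mk (ha ?_)⟩
    simpa [mul_smul] using hy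

theorem nonempty_torsionBySet_quotSMulTop {s : Set R} {a b : R} (has : a ∈ s) (hbs : b ∈ s)
    (ha : IsSMulRegular M a) (hb : IsSMulRegular M b) :
    Nonempty (Submodule.torsionBySet R (QuotSMulTop a M) s ≃ₗ[R]
      Submodule.torsionBySet R (QuotSMulTop b M) s) := by
  obtain ⟨e⟩ := nonempty_torsionBySet_quotSMulTop_mul has ha hb
  obtain ⟨f⟩ := nonempty_torsionBySet_quotSMulTop_mul hbs hb ha
  rw [mul_comm] at f
  exact ⟨e.trans f.symm⟩

theorem exists_mem_isSMulRegular_and_isSMulRegular [IsNoetherianRing R] [Module.Finite R M]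
    {N : Type*} [AddCommGroup N] [Module R N] [Module.Finite R N] {I : Ideal R} {a b : R}
    (haI : a ∈ I) (hbI : b ∈ I) (ha : IsSMulRegular M a) (hb : IsSMulRegular N b) :
    ∃ z ∈ I, IsSMulRegular M z ∧ IsSMulRegular N z := by
  rw [← Ideal.annihilator_quotient (I := I)] at haI hbI
  have := IsSMulRegular.subsingleton_linearMap_iff.2 ⟨a, haI, ha⟩
  have := IsSMulRegular.subsingleton_linearMap_iff.2 ⟨b, hbI, hb⟩
  have := (LinearMap.prodEquiv (R := R) (M := R ⧸ I) (M₂ := M) (M₃ := N) R).symm.subsingleton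
  obtain ⟨z, hz, hMN⟩ := IsSMulRegular.subsingleton_linearMap_iff.1 this
  rw [Ideal.annihilator_quotient] at hz
  exact ⟨z, hz, Prod.isSMulRegular_iff.1 hMN⟩

variable [IsLocalRing R]

theorem isWeaklyRegular_cons_iff_isSMulRegular_quotient [IsNoetherian R M] {as : List R} {a : R}
    (h : ∀ r ∈ a :: as, r ∈ maximalIdeal R) :
    IsWeaklyRegular M (a :: as) ↔ IsWeaklyRegular M as ∧
      IsSMulRegular (M ⧸ (Ideal.ofList as • ⊤ : Submodule R M)) a := by
  have hperm : (as ++ [a]).Perm (a :: as) := List.perm_append_singleton a as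
  rw [← isWeaklyRegular_singleton_iff, ← isWeaklyRegular_append_iff]
  exact ⟨fun h' ↦ isWeaklyRegular_of_perm_of_subset_maximalIdeal h' hperm.symm h,
    fun h' ↦ isWeaklyRegular_of_perm_of_subset_maximalIdeal h' hperm
      fun r hr ↦ h r (hperm.mem_iff.1 hr)⟩

theorem nonempty_socle_quotient_cons {as : List R} {a b : R} (ham : a ∈ maximalIdeal R)
    (hbm : b ∈ maximalIdeal R)
    (ha : IsSMulRegular (M ⧸ (Ideal.ofList as • ⊤ : Submodule R M)) a)
    (hb : IsSMulRegular (M ⧸ (Ideal.ofList as • ⊤ : Submodule R M)) b) :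
    Nonempty (socle R (M ⧸ (Ideal.ofList (a :: as) • ⊤ : Submodule R M)) ≃ₗ[R]
      socle R (M ⧸ (Ideal.ofList (b :: as) • ⊤ : Submodule R M))) := by
  have outer (x : R) := nonempty_torsionBySet_linearEquiv (maximalIdeal R : Set R)
    (Submodule.quotOfListConsSMulTopEquivQuotSMulTopOuter M x as)
  obtain ⟨e⟩ := outer a
  obtain ⟨f⟩ := nonempty_torsionBySet_quotSMulTop (SetLike.mem_coe.2 ham) hbm ha hb
  obtain ⟨g⟩ := outer b
  exact ⟨e.trans (f.trans g.symm)⟩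

variable [IsNoetherianRing R] [Module.Finite R M]

theorem nonempty_socle_quotient_of_isWeaklyRegular {as bs : List R} (ha : IsWeaklyRegular M as)
    (hb : IsWeaklyRegular M bs) (ham : ∀ r ∈ as, r ∈ maximalIdeal R)
    (hbm : ∀ r ∈ bs, r ∈ maximalIdeal R) (hlen : as.length = bs.length) :
    Nonempty (socle R (M ⧸ (Ideal.ofList as • ⊤ : Submodule R M)) ≃ₗ[R]
      socle R (M ⧸ (Ideal.ofList bs • ⊤ : Submodule R M))) := by
  -- Pass from `a :: as` to `b :: bs` through `z :: as` and `z :: bs`, where `z` is regular modulo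
  -- both tails; the middle step is the induction hypothesis for `M ⧸ zM`.
  induction as generalizing M bs with
  | nil =>
    obtain rfl := List.length_eq_zero_iff.1 hlen.symm
    exact ⟨.refl _ _⟩
  | cons a as ih =>
    obtain - | ⟨b, bs⟩ := bs
    · simp at hlen
    have hM : IsNoetherian R M := inferInstance
    obtain ⟨ha', haM⟩ := (isWeaklyRegular_cons_iff_isSMulRegular_quotient ham).1 ha
    obtain ⟨hb', hbM⟩ := (isWeaklyRegular_cons_iff_isSMulRegular_quotient hbm).1 hb
    obtain ⟨ham, ham'⟩ := List.forall_mem_cons.1 ham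
    obtain ⟨hbm, hbm'⟩ := List.forall_mem_cons.1 hbm
    obtain ⟨z, hz, hza, hzb⟩ := exists_mem_isSMulRegular_and_isSMulRegular ham hbm haM hbM
    have regular_mod_z {cs : List R} (hcs : IsWeaklyRegular M cs)
        (hm : ∀ r ∈ cs, r ∈ maximalIdeal R)
        (hzc : IsSMulRegular (M ⧸ (Ideal.ofList cs • ⊤ : Submodule R M)) z) :
        IsWeaklyRegular (QuotSMulTop z M) cs :=
      ((isWeaklyRegular_cons_iff _ _ _).1 <| (isWeaklyRegular_cons_iff_isSMulRegular_quotient <|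
        List.forall_mem_cons.2 ⟨hz, hm⟩).2 ⟨hcs, hzc⟩).2
    have inner (cs : List R) := nonempty_torsionBySet_linearEquiv (maximalIdeal R : Set R)
      (Submodule.quotOfListConsSMulTopEquivQuotSMulTopInner M z cs)
    obtain ⟨e₁⟩ := nonempty_socle_quotient_cons ham hz haM hza
    obtain ⟨e₂⟩ := inner as
    obtain ⟨e₃⟩ := ih (regular_mod_z ha' ham' hza) (regular_mod_z hb' hbm' hzb) ham' hbm'
      (Nat.succ.inj hlen)
    obtain ⟨e₄⟩ := inner bs
    obtain ⟨e₅⟩ := nonempty_socle_quotient_cons hz hbm hzb hbM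
    exact ⟨e₁.trans <| e₂.trans <| e₃.trans <| e₄.symm.trans e₅⟩

theorem length_le_of_socle_quotient_ne_bot {as bs : List R} (ha : IsWeaklyRegular M as)
    (hb : IsWeaklyRegular M bs) (ham : ∀ r ∈ as, r ∈ maximalIdeal R)
    (hbm : ∀ r ∈ bs, r ∈ maximalIdeal R)
    (hsocle : socle R (M ⧸ (Ideal.ofList as • ⊤ : Submodule R M)) ≠ ⊥) :
    bs.length ≤ as.length := by
  by_contra! hlt
  obtain ⟨cs, b, ds, rfl, hcs⟩ : ∃ cs b ds, bs = cs ++ b :: ds ∧ as.length = cs.length :=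
    ⟨bs.take as.length, bs[as.length], bs.drop (as.length + 1), by simp, by simp [hlt.le]⟩
  obtain ⟨hc, hbds⟩ := (isWeaklyRegular_append_iff M _ _).1 hb
  obtain ⟨e⟩ := nonempty_socle_quotient_of_isWeaklyRegular ha hc ham
    (fun r hr ↦ hbm r (List.mem_append_left _ hr)) hcs
  obtain ⟨x, hx, hx0⟩ := Submodule.exists_mem_ne_zero_of_ne_bot hsocle
  have hbx : b • (e ⟨x, hx⟩ : M ⧸ (Ideal.ofList cs • ⊤ : Submodule R M)) = 0 :=
    (Submodule.mem_torsionBySet_iff _ _).1 (e ⟨x, hx⟩).2 ⟨b, hbm b (by simp)⟩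
  have hex : e ⟨x, hx⟩ = 0 :=
    Subtype.ext (((isWeaklyRegular_cons_iff _ _ _).1 hbds).1.right_eq_zero_of_smul hbx)
  exact hx0 (congrArg Subtype.val ((map_eq_zero_iff e e.injective).1 hex))

end RegularSequences

section RegularLocalRing

theorem exists_span_insert_erase_eq {R M : Type*} [CommRing R] [IsLocalRing R] [AddCommGroup M]
    [Module R M] [DecidableEq M] {s : Finset M} {x : M} (hx : x ∈ Submodule.span R (s : Set M))
    (hx' : x ∉ maximalIdeal R • Submodule.span R (s : Set M)) :
    ∃ y ∈ s, Submodule.span R (insert x (s.erase y) : Set M) = Submodule.span R (s : Set M) := by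
  obtain ⟨f, -, hf⟩ := Submodule.mem_span_finset.1 hx
  obtain ⟨y, hys, hy⟩ : ∃ y ∈ s, f y ∉ maximalIdeal R := by
    by_contra! h
    exact hx' (hf ▸ Submodule.sum_mem _ fun y hy ↦
      Submodule.smul_mem_smul (h y hy) (Submodule.subset_span hy))
  have hunit : IsUnit (f y) := by simpa using hy
  refine ⟨y, hys, le_antisymm (Submodule.span_le.2 ?_) (Submodule.span_le.2 fun z hz ↦ ?_)⟩
  · exact Set.insert_subset hx fun z hz ↦ Submodule.subset_span (Finset.mem_of_mem_erase hz)
  · obtain rfl | hzy := eq_or_ne z y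
    · have hfz : f z • z = x - ∑ w ∈ s.erase z, f w • w := by
        rw [← hf, ← Finset.add_sum_erase _ _ hys, add_sub_cancel_right]
      refine (Submodule.smul_mem_iff_of_isUnit _ hunit).1 (hfz ▸ Submodule.sub_mem _ ?_ ?_)
      · exact Submodule.subset_span (Set.mem_insert _ _)
      · exact Submodule.sum_mem _ fun w hw ↦
          Submodule.smul_mem _ _ (Submodule.subset_span (Set.mem_insert_of_mem _ hw))
    · exact Submodule.subset_span (Set.mem_insert_of_mem _ (Finset.mem_erase.2 ⟨hzy, hz⟩))

theorem map_maximalIdeal_eq_of_surjective {R S : Type*} [CommRing R] [CommRing S] [IsLocalRing R]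
    [IsLocalRing S] {f : R →+* S} (hf : Function.Surjective f) :
    (maximalIdeal R).map f = maximalIdeal S := by
  have : IsLocalHom f := .of_surjective f hf
  rw [← maximalIdeal_comap f, Ideal.map_comap_of_surjective f hf]

theorem isWeaklyRegular_cons_iff_quotient_span_singleton {R : Type*} [CommRing R] {x : R}
    {rs : List R} : IsWeaklyRegular R (x :: rs) ↔ IsSMulRegular R x ∧
      IsWeaklyRegular (R ⧸ Ideal.span {x}) (rs.map (Ideal.Quotient.mk (Ideal.span {x}))) := by
  have hx : Ideal.span {x} = x • (⊤ : Submodule R R) := by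
    rw [← Submodule.ideal_span_singleton_smul, smul_eq_mul, Ideal.mul_top]
  rw [isWeaklyRegular_cons_iff, ← Ideal.Quotient.algebraMap_eq,
    isWeaklyRegular_map_algebraMap_iff (R ⧸ Ideal.span {x}) (R ⧸ Ideal.span {x}) rs,
    LinearEquiv.isWeaklyRegular_congr (Submodule.quotEquivOfEq _ _ hx) rs]

variable {R : Type*} [CommRing R]

section NoetherianLocal

variable [IsLocalRing R] [IsNoetherianRing R]

theorem spanFinrank_maximalIdeal_quotient_add_one_le {x : R} [IsLocalRing (R ⧸ Ideal.span {x})]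
    (hx : x ∉ maximalIdeal R ^ 2) :
    (maximalIdeal (R ⧸ Ideal.span {x})).spanFinrank + 1 ≤ (maximalIdeal R).spanFinrank := by
  classical
  have hxm : x ∈ maximalIdeal R := le_maximalIdeal
    (Ideal.Quotient.nontrivial_iff.1 inferInstance) (Ideal.mem_span_singleton_self x)
  obtain ⟨s, hscard, hs⟩ := Submodule.FG.exists_span_finset_card_eq_spanFinrank
    (maximalIdeal R).fg_of_isNoetherianRing
  rw [← hs] at hxm
  obtain ⟨y, hys, hy⟩ := exists_span_insert_erase_eq hxm (by rwa [hs, smul_eq_mul, ← pow_two])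
  have hgen : maximalIdeal (R ⧸ Ideal.span {x}) =
      Ideal.span (Ideal.Quotient.mk (Ideal.span {x}) '' (s.erase y)) := by
    rw [← map_maximalIdeal_eq_of_surjective Ideal.Quotient.mk_surjective, ← hs, ← hy,
      ← Ideal.span, Ideal.map_span, Set.image_insert_eq, Ideal.span_insert,
      Ideal.Quotient.eq_zero_iff_mem.2 (Ideal.mem_span_singleton_self x)]
    simp
  rw [hgen, ← hscard, ← Finset.card_erase_add_one hys, ← Set.ncard_coe_finset]
  gcongr
  exact (Submodule.spanFinrank_span_le_ncard_of_finite ((Finset.finite_toSet _).image _)).trans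
    (Set.ncard_image_le (Finset.finite_toSet _))

theorem exists_mem_maximalIdeal_notMem_sq_forall_notMem_minimalPrimes (h : ringKrullDim R ≠ 0) :
    ∃ x ∈ maximalIdeal R, x ∉ maximalIdeal R ^ 2 ∧ ∀ q ∈ minimalPrimes R, x ∉ q := by
  have hmin : maximalIdeal R ∉ minimalPrimes R := by
    rw [← Ideal.height_eq_zero_iff]
    intro h0
    rw [← maximalIdeal_height_eq_ringKrullDim, h0] at h
    exact h rfl
  have hfin : (insert (maximalIdeal R ^ 2) (minimalPrimes R)).Finite :=
    (minimalPrimes.finite_of_isNoetherianRing R).insert _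
  have havoid : ¬ ((maximalIdeal R : Set R) ⊆
      ⋃ P ∈ insert (maximalIdeal R ^ 2) (minimalPrimes R), (P : Set R)) := by
    intro hsub
    obtain ⟨P, rfl | hP, hle⟩ := (Ideal.subset_union_prime_finite (f := id) hfin
      (maximalIdeal R ^ 2) (maximalIdeal R ^ 2)
      (by rintro P (rfl | hP) hP2 - <;> [exact absurd rfl hP2; exact hP.isPrime])).1 hsub
    · have hbot : maximalIdeal R = ⊥ := Submodule.eq_bot_of_le_smul_of_le_jacobson_bot
        (maximalIdeal R) _ (maximalIdeal R).fg_of_isNoetherianRing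
        (by rwa [smul_eq_mul, ← pow_two]) (maximalIdeal_le_jacobson _)
      exact hmin ⟨⟨inferInstance, bot_le⟩, fun Q _ _ ↦ hbot ▸ bot_le⟩
    · exact hmin (((le_maximalIdeal hP.isPrime.ne_top).antisymm hle) ▸ hP)
  obtain ⟨x, hx, hx'⟩ := Set.not_subset.1 havoid
  simp only [Set.mem_iUnion, not_exists] at hx'
  exact ⟨x, hx, hx' _ (Set.mem_insert _ _), fun q hq ↦ hx' q (Set.mem_insert_of_mem _ hq)⟩

theorem isDomain_of_isPrime_span_singleton {x : R} (hx : (Ideal.span {x}).IsPrime)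
    (hmin : ∀ q ∈ minimalPrimes R, x ∉ q) : IsDomain R := by
  obtain ⟨q, hq, hqx⟩ := Ideal.exists_minimalPrimes_le (bot_le : (⊥ : Ideal R) ≤ Ideal.span {x})
  have hqp := hq.isPrime
  have hxm : x ∈ maximalIdeal R := le_maximalIdeal hx.ne_top (Ideal.mem_span_singleton_self x)
  have hle : q ≤ maximalIdeal R • q := fun a ha ↦ by
    obtain ⟨b, rfl⟩ := Ideal.mem_span_singleton'.1 (hqx ha)
    rw [mul_comm]
    exact Submodule.smul_mem_smul hxm ((hqp.mem_or_mem ha).resolve_right (hmin q hq))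
  have hbot : q = ⊥ := Submodule.eq_bot_of_le_smul_of_le_jacobson_bot (maximalIdeal R) q
    q.fg_of_isNoetherianRing hle (maximalIdeal_le_jacobson _)
  rw [hbot] at hqp
  exact IsDomain.of_bot_isPrime R

end NoetherianLocal

theorem maximalIdeal_eq_bot_of_ringKrullDim_eq_zero [IsRegularLocalRing R]
    (h : ringKrullDim R = 0) : maximalIdeal R = ⊥ := by
  have hspan := (isRegularLocalRing_iff R).1 ‹_›
  rwa [h, Nat.cast_eq_zero, Submodule.spanFinrank_eq_zero_iff_eq_bot
    (maximalIdeal R).fg_of_isNoetherianRing] at hspan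

theorem isRegularLocalRing_quotient_and_ringKrullDim_add_one [IsRegularLocalRing R] {x : R}
    (hx : x ∈ maximalIdeal R) (hx2 : x ∉ maximalIdeal R ^ 2) :
    IsRegularLocalRing (R ⧸ Ideal.span {x}) ∧
      ringKrullDim (R ⧸ Ideal.span {x}) + 1 = ringKrullDim R := by
  have : Nontrivial (R ⧸ Ideal.span {x}) := Ideal.Quotient.nontrivial_iff.2
    (ne_top_of_le_ne_top (maximalIdeal.isMaximal R).ne_top
      ((Ideal.span_singleton_le_iff_mem _).2 hx))
  have : IsLocalRing (R ⧸ Ideal.span {x}) := .of_surjective' _ Ideal.Quotient.mk_surjective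
  have hdim : ringKrullDim R ≤ ringKrullDim (R ⧸ Ideal.span {x}) + 1 := by
    have h := ringKrullDim_le_ringKrullDim_quotient_add_card {x}
      (by simpa [ringJacobson_eq_maximalIdeal] using hx)
    rwa [Finset.coe_singleton, Finset.card_singleton, Nat.cast_one] at h
  have hrank : ((maximalIdeal (R ⧸ Ideal.span {x})).spanFinrank : WithBot ℕ∞) + 1 ≤
      ringKrullDim R := by
    rw [← (isRegularLocalRing_iff R).1 ‹_›]
    exact_mod_cast spanFinrank_maximalIdeal_quotient_add_one_le hx2
  have hreg : IsRegularLocalRing (R ⧸ Ideal.span {x}) :=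
    .of_spanFinrank_maximalIdeal_le _
      (ENat.WithBot.add_le_add_one_right_iff.1 (hrank.trans hdim))
  exact ⟨hreg, ((isRegularLocalRing_iff _).1 hreg ▸ hrank).antisymm hdim⟩

theorem isDomain_of_isRegularLocalRing [IsRegularLocalRing R] : IsDomain R := by
  obtain ⟨d, hd⟩ : ∃ d : ℕ, ringKrullDim R = d := ⟨_, ((isRegularLocalRing_iff R).1 ‹_›).symm⟩
  induction d generalizing R with
  | zero =>
    have := (maximalIdeal.isMaximal R).isPrime
    rw [maximalIdeal_eq_bot_of_ringKrullDim_eq_zero hd] at this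
    exact IsDomain.of_bot_isPrime R
  | succ d ih =>
    obtain ⟨x, hx, hx2, hxmin⟩ := exists_mem_maximalIdeal_notMem_sq_forall_notMem_minimalPrimes
      (R := R) (by rw [hd]; exact_mod_cast d.succ_ne_zero)
    obtain ⟨_, hdim⟩ := isRegularLocalRing_quotient_and_ringKrullDim_add_one hx hx2
    have := ih (R := R ⧸ Ideal.span {x}) (ENat.WithBot.add_one_cancel.1 (by simpa [hd] using hdim))
    exact isDomain_of_isPrime_span_singleton ((Ideal.Quotient.isDomain_iff_prime _).1 this) hxmin

theorem exists_isWeaklyRegular_ofList_eq_maximalIdeal (R : Type*) [CommRing R]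
    [IsRegularLocalRing R] : ∃ ps : List R, IsWeaklyRegular R ps ∧
      Ideal.ofList ps = maximalIdeal R ∧ (ps.length : WithBot ℕ∞) = ringKrullDim R := by
  obtain ⟨d, hd⟩ : ∃ d : ℕ, ringKrullDim R = d := ⟨_, ((isRegularLocalRing_iff R).1 ‹_›).symm⟩
  induction d generalizing R with
  | zero =>
    exact ⟨[], .nil R R, by rw [Ideal.ofList_nil, maximalIdeal_eq_bot_of_ringKrullDim_eq_zero hd],
      hd.symm⟩
  | succ d ih =>
    obtain ⟨x, hx, hx2, -⟩ := exists_mem_maximalIdeal_notMem_sq_forall_notMem_minimalPrimes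
      (R := R) (by rw [hd]; exact_mod_cast d.succ_ne_zero)
    obtain ⟨_, hdim⟩ := isRegularLocalRing_quotient_and_ringKrullDim_add_one hx hx2
    obtain ⟨ps, hps, hpsm, hlen⟩ :=
      ih (R ⧸ Ideal.span {x}) (ENat.WithBot.add_one_cancel.1 (by simpa [hd] using hdim))
    obtain ⟨ps, rfl⟩ := List.map_surjective_iff.2 Ideal.Quotient.mk_surjective ps
    have := isDomain_of_isRegularLocalRing (R := R)
    have hx0 : x ≠ 0 := fun h ↦ hx2 (h ▸ Ideal.zero_mem _)
    refine ⟨x :: ps, isWeaklyRegular_cons_iff_quotient_span_singleton.2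
      ⟨.of_ne_zero hx0, hps⟩, ?_, ?_⟩
    · have : IsLocalHom (Ideal.Quotient.mk (Ideal.span {x})) :=
        .of_surjective _ Ideal.Quotient.mk_surjective
      rw [Ideal.ofList_cons, ← maximalIdeal_comap (Ideal.Quotient.mk (Ideal.span {x})), ← hpsm,
        ← Ideal.map_ofList, Ideal.comap_map_of_surjective' _ Ideal.Quotient.mk_surjective,
        Ideal.mk_ker, sup_comm]
    · rw [← hdim, ← hlen, List.length_map, List.length_cons, Nat.cast_add, Nat.cast_one]

end RegularLocalRing

section SystemsOfParameters

variable {R : Type*} [CommRing R] [IsLocalRing R]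

theorem socle_quotient_ne_bot_of_maximalIdeal_eq_colon {J : Ideal R} {x : R}
    (hx : maximalIdeal R = J.colon {x}) : socle R (R ⧸ J) ≠ ⊥ := by
  refine (Submodule.ne_bot_iff _).2
    ⟨Submodule.Quotient.mk x, (Submodule.mem_torsionBySet_iff _ _).2 fun a ↦ ?_, fun h ↦ ?_⟩
  · rw [← Submodule.Quotient.mk_smul, Submodule.Quotient.mk_eq_zero]
    exact Submodule.mem_colon_singleton.1 (hx ▸ a.2)
  · refine (Ideal.ne_top_iff_one _).1 (maximalIdeal.isMaximal R).ne_top ?_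
    rw [hx, Submodule.mem_colon_singleton, one_smul]
    exact (Submodule.Quotient.mk_eq_zero _).1 h

variable [IsNoetherianRing R]

theorem nonempty_socle_quotient_ofList {as bs : List R} (ha : IsWeaklyRegular R as)
    (hb : IsWeaklyRegular R bs) (ham : Ideal.ofList as ≤ maximalIdeal R)
    (hbm : Ideal.ofList bs ≤ maximalIdeal R) (hlen : as.length = bs.length) :
    Nonempty (socle R (R ⧸ Ideal.ofList as) ≃ₗ[R] socle R (R ⧸ Ideal.ofList bs)) := by
  rw [← Ideal.mul_top (Ideal.ofList as), ← Ideal.mul_top (Ideal.ofList bs)]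
  exact nonempty_socle_quotient_of_isWeaklyRegular ha hb
    (fun r hr ↦ ham (Ideal.subset_span hr)) (fun r hr ↦ hbm (Ideal.subset_span hr)) hlen

theorem length_le_of_maximalIdeal_eq_colon {as bs : List R} (ha : IsWeaklyRegular R as)
    (hb : IsWeaklyRegular R bs) (hbm : Ideal.ofList bs ≤ maximalIdeal R) {x : R}
    (hx : maximalIdeal R = (Ideal.ofList as).colon {x}) : bs.length ≤ as.length := by
  have hsocle := socle_quotient_ne_bot_of_maximalIdeal_eq_colon hx
  rw [← Ideal.mul_top (Ideal.ofList as)] at hsocle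
  have ham : Ideal.ofList as ≤ maximalIdeal R := hx ▸ Ideal.le_colon
  exact length_le_of_socle_quotient_ne_bot ha hb (fun r hr ↦ ham (Ideal.subset_span hr))
    (fun r hr ↦ hbm (Ideal.subset_span hr)) hsocle

theorem isFiniteLength_quotient_ofList {rs : List R} (hrs : IsWeaklyRegular R rs)
    (hm : Ideal.ofList rs ≤ maximalIdeal R)
    (hlen : (rs.length : WithBot ℕ∞) = ringKrullDim R) :
    IsFiniteLength R (R ⧸ Ideal.ofList rs) := by
  have hdim := ringKrullDim_add_length_eq_ringKrullDim_of_isRegular rs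
    ((isRegular_iff_isWeaklyRegular_of_subset_maximalIdeal
      fun r hr ↦ hm (Ideal.subset_span hr)).2 hrs)
  have hzero : ringKrullDim (R ⧸ Ideal.ofList rs) = 0 :=
    ENat.WithBot.add_natCast_cancel.1 (hdim.trans (by rw [zero_add, hlen]))
  have : Ring.KrullDimLE 0 (R ⧸ Ideal.ofList rs) := Ring.krullDimLE_iff.2 hzero.le
  have : IsArtinianRing (R ⧸ Ideal.ofList rs) :=
    isArtinianRing_iff_isNoetherianRing_krullDimLE_zero.2 ⟨inferInstance, inferInstance⟩
  exact isFiniteLength_iff_isNoetherian_isArtinian.2 ⟨inferInstance,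
    isArtinian_of_surjective_algebraMap (R := R ⧸ Ideal.ofList rs) (S := R)
      Ideal.Quotient.mk_surjective⟩

end SystemsOfParameters

section RegularLocalRing

variable {R : Type*} [CommRing R] [IsRegularLocalRing R] {rs : List R}

theorem length_eq_ringKrullDim_of_maximalIdeal_eq_colon (hrs : IsWeaklyRegular R rs) {x : R}
    (hx : maximalIdeal R = (Ideal.ofList rs).colon {x}) :
    (rs.length : WithBot ℕ∞) = ringKrullDim R := by
  obtain ⟨ps, hps, hpsm, hlen⟩ := exists_isWeaklyRegular_ofList_eq_maximalIdeal R
  have hone : maximalIdeal R = (Ideal.ofList ps).colon {1} := by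
    ext r
    rw [hpsm, Submodule.mem_colon_singleton, smul_eq_mul, mul_one]
  rw [← hlen, (length_le_of_maximalIdeal_eq_colon hps hrs (hx ▸ Ideal.le_colon) hone).antisymm
    (length_le_of_maximalIdeal_eq_colon hrs hps hpsm.le hx)]

theorem length_socle_quotient_ofList_le_one (hrs : IsWeaklyRegular R rs)
    (hm : Ideal.ofList rs ≤ maximalIdeal R)
    (hlen : (rs.length : WithBot ℕ∞) = ringKrullDim R) :
    Module.length R (socle R (R ⧸ Ideal.ofList rs)) ≤ 1 := by
  obtain ⟨ps, hps, hpsm, hplen⟩ := exists_isWeaklyRegular_ofList_eq_maximalIdeal R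
  obtain ⟨e⟩ := nonempty_socle_quotient_ofList hrs hps hm hpsm.le
    (by exact_mod_cast hlen.trans hplen.symm)
  have : IsSimpleModule R (R ⧸ maximalIdeal R) :=
    isSimpleModule_iff_isCoatom.2 (maximalIdeal.isMaximal R).out
  rw [e.length_eq, hpsm, ← Module.length_eq_one R (R ⧸ maximalIdeal R)]
  exact Module.length_le_of_injective _ (Submodule.subtype_injective _)

theorem colon_colon_ofList_eq_of_length_eq_ringKrullDim (hrs : IsWeaklyRegular R rs)
    (hm : Ideal.ofList rs ≤ maximalIdeal R)
    (hlen : (rs.length : WithBot ℕ∞) = ringKrullDim R) {I : Ideal R} (hI : Ideal.ofList rs ≤ I) :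
    (Ideal.ofList rs).colon ((Ideal.ofList rs).colon (I : Set R) : Set R) = I :=
  colon_colon_eq_of_length_socle_le_one hI (isFiniteLength_quotient_ofList hrs hm hlen)
    (length_socle_quotient_ofList_le_one hrs hm hlen)

end RegularLocalRing

section ColonIdeals

variable {R : Type*} [CommRing R]

theorem le_colon_colon {I J : Ideal R} : I ≤ J.colon (J.colon (I : Set R) : Set R) :=
  fun x hx ↦ Submodule.mem_colon.2 fun k hk ↦ by
    simpa only [smul_eq_mul, mul_comm] using Submodule.mem_colon.1 hk x hx

theorem colon_sup (J K L : Ideal R) :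
    J.colon ((K ⊔ L : Ideal R) : Set R) = J.colon (K : Set R) ⊓ J.colon (L : Set R) := by
  rw [← Submodule.colon_union, ← Ideal.colon_span (S := (K ∪ L : Set R)), Ideal.span_union,
    Ideal.span_eq, Ideal.span_eq]

theorem map_colon_le {S : Type*} [CommRing S] (φ : R →+* S) (J K : Ideal R) :
    (J.colon (K : Set R)).map φ ≤ (J.map φ).colon (K.map φ : Set S) := by
  refine Ideal.map_le_iff_le_comap.2 fun r hr ↦ ?_
  rw [Ideal.mem_comap, ← Ideal.span_eq K, Ideal.map_span, Ideal.colon_span,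
    Submodule.mem_colon]
  rintro _ ⟨k, hk, rfl⟩
  rw [smul_eq_mul, ← map_mul]
  exact Ideal.mem_map_of_mem φ (Submodule.mem_colon.1 hr k hk)

variable (M : Submonoid R) (S : Type*) [CommRing S] [Algebra R S] [IsLocalization M S]

include M in
theorem map_colon_singleton_of_isLocalization (J : Ideal R) (x : R) :
    (J.colon {x}).map (algebraMap R S) = (J.map (algebraMap R S)).colon {algebraMap R S x} := by
  refine le_antisymm ?_ fun y hy ↦ ?_
  · simpa only [Ideal.map_span, Set.image_singleton, Ideal.colon_span] using
      map_colon_le (algebraMap R S) J (Ideal.span {x})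
  · obtain ⟨z, s, rfl⟩ := IsLocalization.exists_mk'_eq M y
    rw [IsLocalization.mk'_mem_iff, Submodule.mem_colon_singleton, smul_eq_mul, ← map_mul,
      IsLocalization.algebraMap_mem_map_algebraMap_iff M] at hy
    obtain ⟨t, ht, htz⟩ := hy
    rw [IsLocalization.mk'_mem_map_algebraMap_iff]
    exact ⟨t, ht, Submodule.mem_colon_singleton.2 (by rwa [smul_eq_mul, mul_assoc])⟩

include M in
theorem map_colon_of_isLocalization (J : Ideal R) {K : Ideal R} (hK : K.FG) :
    (J.colon (K : Set R)).map (algebraMap R S) =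
      (J.map (algebraMap R S)).colon (K.map (algebraMap R S) : Set S) := by
  induction K, hK using Submodule.fg_induction with
  | singleton x =>
    rw [Ideal.submodule_span_eq, Ideal.map_span, Set.image_singleton, Ideal.colon_span,
      Ideal.colon_span, map_colon_singleton_of_isLocalization M]
  | sup K L _ _ hK hL =>
    rw [colon_sup, IsLocalization.map_inf M, hK, hL, Ideal.map_sup, colon_sup]

end ColonIdeals

section AssociatedPrimes

variable {R : Type*} [CommRing R] [IsNoetherianRing R]

theorem mem_associatedPrimes_quotient_iff {I P : Ideal R} :
    P ∈ associatedPrimes R (R ⧸ I) ↔ P.IsPrime ∧ ∃ x, P = I.colon {x} := by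
  rw [AssociatedPrimes.mem_iff, isAssociatedPrime_iff, Submodule.mkQ_surjective I |>.exists]
  refine and_congr_right fun _ ↦ exists_congr fun x ↦ ?_
  have : (⊥ : Submodule R (R ⧸ I)).colon {I.mkQ x} = I.colon {x} := by
    ext r
    rw [Submodule.mem_colon_singleton, Submodule.mem_colon_singleton, Submodule.mem_bot,
      ← map_smul, Submodule.mkQ_apply, Submodule.Quotient.mk_eq_zero]
  rw [this]

theorem associatedPrimes_quotient_colon_subset (J K : Ideal R) :
    associatedPrimes R (R ⧸ J.colon (K : Set R)) ⊆ associatedPrimes R (R ⧸ J) := by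
  intro P hP
  obtain ⟨hprime, x, hx⟩ := mem_associatedPrimes_quotient_iff.1 hP
  suffices ∃ y, P = J.colon {y} from mem_associatedPrimes_quotient_iff.2 ⟨hprime, this⟩
  clear hP
  induction K, IsNoetherian.noetherian K using Submodule.fg_induction with
  | singleton k =>
    refine ⟨x * k, hx.trans ?_⟩
    ext r
    rw [Ideal.submodule_span_eq, Ideal.colon_span, Submodule.mem_colon_singleton,
      Submodule.mem_colon_singleton, Submodule.mem_colon_singleton, smul_assoc, smul_eq_mul x]
  | sup K L _ _ hK hL =>
    rw [colon_sup, Submodule.inf_colon] at hx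
    obtain h | h := hprime.inf_le.1 hx.ge
    · exact hK (h.antisymm' (hx.trans_le inf_le_left))
    · exact hL (h.antisymm' (hx.trans_le inf_le_right))

theorem associatedPrimes_map_mkQ_eq_sdiff_minimalPrimes {I U : Ideal R} (hIU : I ≤ U)
    (hU : ∀ P ∈ associatedPrimes R (R ⧸ U), P ∈ I.minimalPrimes)
    (hmin : ∀ P ∈ I.minimalPrimes, ∀ x ∈ U, ¬ I.colon {x} ≤ P) :
    associatedPrimes R (Submodule.map (Submodule.mkQ I) U) =
      associatedPrimes R (R ⧸ I) \ I.minimalPrimes := by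
  let N : Submodule R (R ⧸ I) := Submodule.map (Submodule.mkQ I) U
  have hexact : Function.Exact N.subtype (Submodule.factor hIU) := by
    rw [LinearMap.exact_iff, Submodule.ker_mapQ, Submodule.range_subtype, Submodule.comap_id]
  apply subset_antisymm
  · intro P hP
    refine ⟨associatedPrimes.subset_of_injective N.subtype_injective hP, fun hPmin ↦ ?_⟩
    obtain ⟨-, ⟨_, x, hxU, rfl⟩, hx⟩ := isAssociatedPrime_iff.1 hP
    refine hmin P hPmin x hxU (le_of_le_of_eq (fun r hr ↦ ?_) hx.symm)
    rw [Submodule.mem_colon_singleton] at hr ⊢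
    exact Subtype.ext ((Submodule.Quotient.mk_eq_zero I).2 hr)
  · rintro P ⟨hP, hPmin⟩
    exact (associatedPrimes.subset_union_of_exact N.subtype_injective hexact hP).resolve_right
      fun h ↦ hPmin (hU P h)

end AssociatedPrimes

section RegularRing

variable {R : Type*} [CommRing R] [IsRegularRing R] {rs : List R} {I : Ideal R}

theorem height_eq_length_of_mem_associatedPrimes (hrs : IsWeaklyRegular R rs) {P : Ideal R}
    (hP : P ∈ associatedPrimes R (R ⧸ Ideal.ofList rs)) : P.height = rs.length := by
  obtain ⟨hprime, x, hx⟩ := mem_associatedPrimes_quotient_iff.1 hP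
  have hm : maximalIdeal (Localization.AtPrime P) =
      (Ideal.ofList (rs.map (algebraMap R (Localization.AtPrime P)))).colon
        {algebraMap R (Localization.AtPrime P) x} := by
    rw [← Localization.AtPrime.map_eq_maximalIdeal, ← Ideal.map_ofList,
      ← map_colon_singleton_of_isLocalization P.primeCompl, ← hx]
  have h := length_eq_ringKrullDim_of_maximalIdeal_eq_colon
    (hrs.of_isLocalization (Localization.AtPrime P) P.primeCompl) hm
  rw [IsLocalization.AtPrime.ringKrullDim_eq_height P, List.length_map] at h
  exact_mod_cast h.symm

theorem mem_minimalPrimes_of_mem_associatedPrimes_colon_colon (hrs : IsWeaklyRegular R rs)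
    (hlen : (rs.length : ℕ∞) = I.height) {P : Ideal R}
    (hP : P ∈ associatedPrimes R
      (R ⧸ (Ideal.ofList rs).colon ((Ideal.ofList rs).colon (I : Set R) : Set R))) :
    P ∈ I.minimalPrimes := by
  obtain ⟨_, x, hx⟩ := mem_associatedPrimes_quotient_iff.1 hP
  have hIP : I ≤ P := hx ▸ le_colon_colon.trans Ideal.le_colon
  refine Ideal.mem_minimalPrimes_of_height_le hIP ?_
  rw [height_eq_length_of_mem_associatedPrimes hrs (associatedPrimes_quotient_colon_subset _ _ hP),
    hlen]

theorem not_colon_singleton_le_of_mem_colon_colon (hrs : IsWeaklyRegular R rs)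
    (hJI : Ideal.ofList rs ≤ I) {P : Ideal R} [P.IsPrime] (hIP : I ≤ P)
    (hP : P.height = rs.length) {x : R}
    (hx : x ∈ (Ideal.ofList rs).colon ((Ideal.ofList rs).colon (I : Set R) : Set R)) :
    ¬ I.colon {x} ≤ P := by
  let φ := algebraMap R (Localization.AtPrime P)
  have hlinkage : ((Ideal.ofList rs).map φ).colon
      (((Ideal.ofList rs).map φ).colon (I.map φ : Set _) : Set _) = I.map φ := by
    have hJP : (Ideal.ofList rs).map φ ≤ maximalIdeal _ :=
      Localization.AtPrime.map_eq_maximalIdeal (I := P) ▸ Ideal.map_mono (hJI.trans hIP)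
    have hJI' := Ideal.map_mono (f := φ) hJI
    rw [Ideal.map_ofList] at hJP hJI' ⊢
    refine colon_colon_ofList_eq_of_length_eq_ringKrullDim
      (hrs.of_isLocalization (Localization.AtPrime P) P.primeCompl) hJP ?_ hJI'
    rw [IsLocalization.AtPrime.ringKrullDim_eq_height P, List.length_map, hP, WithBot.coe_natCast]
  have hxI : φ x ∈ I.map φ := by
    rw [← hlinkage, ← map_colon_of_isLocalization P.primeCompl _ _ (IsNoetherian.noetherian I)]
    exact map_colon_le φ _ _ (Ideal.mem_map_of_mem φ hx)
  obtain ⟨s, hs, hsx⟩ := (IsLocalization.algebraMap_mem_map_algebraMap_iff P.primeCompl _ _ _).1 hxI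
  exact fun h ↦ hs (h (Submodule.mem_colon_singleton.2 hsx))

theorem associatedPrimes_map_mkQ_colon_colon (hrs : IsWeaklyRegular R rs)
    (hlen : (rs.length : ℕ∞) = I.height) (hJI : Ideal.ofList rs ≤ I)
    (hht : ∀ P ∈ I.minimalPrimes, P.height = I.height) :
    associatedPrimes R (Submodule.map (Submodule.mkQ I)
      ((Ideal.ofList rs).colon ((Ideal.ofList rs).colon (I : Set R) : Set R))) =
      associatedPrimes R (R ⧸ I) \ I.minimalPrimes := by
  refine associatedPrimes_map_mkQ_eq_sdiff_minimalPrimes le_colon_colon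
    (fun P hP ↦ mem_minimalPrimes_of_mem_associatedPrimes_colon_colon hrs hlen hP)
    fun P hP x hx ↦ ?_
  have := hP.isPrime
  exact not_colon_singleton_le_of_mem_colon_colon hrs hJI hP.le
    ((hht P hP).trans hlen.symm) hx

end RegularRing

section QuotientRing

theorem isPrime_of_isPrime_comap_of_surjective {R B : Type*} [CommRing R] [CommRing B]
    {f : R →+* B} (hf : Function.Surjective f) {Q : Ideal B} [(Q.comap f).IsPrime] :
    Q.IsPrime :=
  Ideal.map_comap_of_surjective f hf Q ▸
    Ideal.map_isPrime_of_surjective hf (Ideal.comap_mono bot_le)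

theorem image_comap_associatedPrimes {R B M : Type*} [CommRing R] [CommRing B] [Algebra R B]
    [AddCommGroup M] [Module R M] [Module B M] [IsScalarTower R B M]
    (hB : Function.Surjective (algebraMap R B)) :
    Ideal.comap (algebraMap R B) '' associatedPrimes B M = associatedPrimes R M := by
  have hcolon (x : M) : ((⊥ : Submodule B M).colon {x}).comap (algebraMap R B) =
      (⊥ : Submodule R M).colon {x} := by
    ext r
    rw [Ideal.mem_comap, Submodule.mem_colon_singleton, Submodule.mem_colon_singleton,
      algebraMap_smul, Submodule.mem_bot, Submodule.mem_bot]
  apply subset_antisymm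
  · rintro _ ⟨Q, ⟨_, x, rfl⟩, rfl⟩
    exact ⟨Ideal.comap_isPrime _ _, x, by rw [Ideal.comap_radical, hcolon]⟩
  · rintro P ⟨hP, x, rfl⟩
    rw [← hcolon, ← Ideal.comap_radical] at hP ⊢
    exact ⟨_, ⟨isPrime_of_isPrime_comap_of_surjective hB, x, rfl⟩, rfl⟩

theorem image_comap_embeddedPrimes_quotient {R : Type*} [CommRing R] (I : Ideal R) :
    Ideal.comap (Ideal.Quotient.mk I) '' embeddedPrimes (R ⧸ I) =
      associatedPrimes R (R ⧸ I) \ I.minimalPrimes := by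
  rw [embeddedPrimes, Set.image_sdiff (Ideal.comap_injective_of_surjective _
    Ideal.Quotient.mk_surjective), ← Ideal.minimalPrimes_eq_comap,
    ← image_comap_associatedPrimes (B := R ⧸ I) Ideal.Quotient.mk_surjective,
    Ideal.Quotient.algebraMap_eq]

theorem hasNoEmbeddedComponents_quotient_iff {R : Type*} [CommRing R] {I : Ideal R} :
    HasNoEmbeddedComponents (R ⧸ I) ↔ associatedPrimes R (R ⧸ I) \ I.minimalPrimes = ∅ := by
  rw [HasNoEmbeddedComponents, ← image_comap_embeddedPrimes_quotient, Set.image_eq_empty]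

theorem isInternallyFlat_quotient_iff {A R : Type*} [CommRing A] [CommRing R] [Algebra A R]
    {I : Ideal R} : IsInternallyFlat A (R ⧸ I) ↔
      ∀ P ∈ associatedPrimes R (R ⧸ I) \ I.minimalPrimes, P.comap (algebraMap A R) = ⊥ := by
  rw [IsInternallyFlat, ← image_comap_embeddedPrimes_quotient, Set.forall_mem_image]
  rfl

theorem isSMulRegular_map_mkQ_iff {R M : Type*} [CommRing R] [AddCommGroup M] [Module R M]
    {N U : Submodule R M} {r : R} :
    IsSMulRegular (U.map N.mkQ) r ↔ ∀ x ∈ U, r • x ∈ N → x ∈ N := by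
  simp only [isSMulRegular_submodule_iff_right_eq_zero_of_smul, Submodule.mem_map,
    forall_exists_index, and_imp, forall_apply_eq_imp_iff₂, Submodule.mkQ_apply,
    ← Submodule.Quotient.mk_smul, Submodule.Quotient.mk_eq_zero]

theorem associatedPrimes_eq_empty_iff {R M : Type*} [CommRing R] [IsNoetherianRing R]
    [AddCommGroup M] [Module R M] : associatedPrimes R M = ∅ ↔ Subsingleton M := by
  refine ⟨fun h ↦ ?_, fun _ ↦ associatedPrimes.eq_empty_of_subsingleton⟩
  by_contra hM
  rw [not_subsingleton_iff_nontrivial] at hM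
  exact (associatedPrimes.nonempty R M).ne_empty h

theorem isSMulRegular_iff_forall_notMem_associatedPrimes {R M : Type*} [CommRing R]
    [IsNoetherianRing R] [AddCommGroup M] [Module R M] {r : R} :
    IsSMulRegular M r ↔ ∀ P ∈ associatedPrimes R M, r ∉ P := by
  have h := Set.ext_iff.1 (biUnion_associatedPrimes_eq_compl_regular R M) r
  simpa only [Set.mem_iUnion, SetLike.mem_coe, exists_prop, Set.mem_compl_iff, Set.mem_ofPred_eq,
    not_exists, not_and, not_not, iff_not_comm (b := IsSMulRegular M r)] using h

end QuotientRing

section DiscreteValuationRing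

variable {A : Type*} [CommRing A] [IsDomain A] [IsDiscreteValuationRing A] {τ : A}

theorem eq_bot_iff_notMem_of_isPrime (hτ : Irreducible τ) {p : Ideal A} [p.IsPrime] :
    p = ⊥ ↔ τ ∉ p := by
  refine ⟨fun h ↦ h ▸ hτ.ne_zero, fun h ↦ ?_⟩
  by_contra hp
  have : p.IsMaximal := IsPrime.to_maximal_ideal hp
  exact h (IsLocalRing.eq_maximalIdeal this ▸ hτ.not_isUnit)

theorem flat_iff_isSMulRegular (hτ : Irreducible τ) {M : Type*} [AddCommGroup M] [Module A M] :
    Module.Flat A M ↔ IsSMulRegular M τ := by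
  refine ⟨fun _ ↦ Module.Flat.isSMulRegular_of_nonZeroDivisors
    (mem_nonZeroDivisors_of_ne_zero hτ.ne_zero), fun h ↦ ?_⟩
  have : Module.IsTorsionFree A M := by
    refine ⟨fun r hr ↦ ?_⟩
    obtain ⟨k, u, rfl⟩ := IsDiscreteValuationRing.eq_unit_mul_pow_irreducible hr.ne_zero hτ
    exact (IsUnit.isSMulRegular M u.isUnit).mul (h.pow k)
  infer_instance

theorem flat_quotient_iff_colon_le (hτ : Irreducible τ) {R : Type*} [CommRing R] [Algebra A R]
    {I : Ideal R} : Module.Flat A (R ⧸ I) ↔ I.colon {algebraMap A R τ} ≤ I := by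
  have h : IsSMulRegular (R ⧸ I) τ ↔ IsSMulRegular (R ⧸ I) (algebraMap A R τ) := by
    simp only [IsSMulRegular, algebraMap_smul]
  rw [flat_iff_isSMulRegular hτ, h, isSMulRegular_quotient_iff_mem_of_smul_mem]
  refine forall_congr' fun x ↦ ?_
  rw [Submodule.mem_colon_singleton, smul_eq_mul, smul_eq_mul, mul_comm]

end DiscreteValuationRing

section RegularRing

variable {R : Type*} [CommRing R] [IsRegularRing R] {rs : List R} {I : Ideal R}

theorem hasNoEmbeddedComponents_quotient_iff_colon_colon_le (hrs : IsWeaklyRegular R rs)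
    (hlen : (rs.length : ℕ∞) = I.height) (hJI : Ideal.ofList rs ≤ I)
    (hht : ∀ P ∈ I.minimalPrimes, P.height = I.height) :
    HasNoEmbeddedComponents (R ⧸ I) ↔
      (Ideal.ofList rs).colon ((Ideal.ofList rs).colon (I : Set R) : Set R) ≤ I := by
  rw [hasNoEmbeddedComponents_quotient_iff,
    ← associatedPrimes_map_mkQ_colon_colon hrs hlen hJI hht, associatedPrimes_eq_empty_iff,
    Submodule.subsingleton_iff_eq_bot, ← le_bot_iff, Submodule.map_le_iff_le_comap,
    Submodule.comap_bot, Submodule.ker_mkQ]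

theorem isInternallyFlat_quotient_iff_colon_inf_colon_colon_le {A : Type*} [CommRing A] [IsDomain A]
    [IsDiscreteValuationRing A] [Algebra A R] {τ : A} (hτ : Irreducible τ)
    (hrs : IsWeaklyRegular R rs) (hlen : (rs.length : ℕ∞) = I.height) (hJI : Ideal.ofList rs ≤ I)
    (hht : ∀ P ∈ I.minimalPrimes, P.height = I.height) :
    IsInternallyFlat A (R ⧸ I) ↔ I.colon {algebraMap A R τ} ⊓
      (Ideal.ofList rs).colon ((Ideal.ofList rs).colon (I : Set R) : Set R) ≤ I := by
  set U := (Ideal.ofList rs).colon ((Ideal.ofList rs).colon (I : Set R) : Set R)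
  calc IsInternallyFlat A (R ⧸ I)
      ↔ ∀ P ∈ associatedPrimes R (Submodule.map (Submodule.mkQ I) U),
          algebraMap A R τ ∉ P := by
        rw [isInternallyFlat_quotient_iff,
          ← associatedPrimes_map_mkQ_colon_colon hrs hlen hJI hht]
        refine forall₂_congr fun P hP ↦ ?_
        have := hP.isPrime
        rw [eq_bot_iff_notMem_of_isPrime hτ, Ideal.mem_comap]
    _ ↔ ∀ x ∈ U, algebraMap A R τ • x ∈ I → x ∈ I := by
        rw [← isSMulRegular_iff_forall_notMem_associatedPrimes, isSMulRegular_map_mkQ_iff]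
    _ ↔ I.colon {algebraMap A R τ} ⊓ U ≤ I := by
        refine forall_congr' fun x ↦ ?_
        rw [Submodule.mem_inf, Submodule.mem_colon_singleton, smul_eq_mul, smul_eq_mul, mul_comm,
          and_comm, and_imp]

end RegularRing

section DimensionFormula

open Polynomial

theorem height_eq_one_of_comap_C_eq_bot {D : Type*} [CommRing D] [IsDomain D] [IsNoetherianRing D]
    {Q : Ideal D[X]} [Q.IsPrime] (hQ : Q ≠ ⊥) (hc : Q.comap C = ⊥) : Q.height = 1 := by
  apply le_antisymm
  · let K := FractionRing D
    let : Algebra D[X] K[X] := Polynomial.algebra D K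
    let M : Submonoid D[X] := (nonZeroDivisors D).map C
    have : IsLocalization M K[X] := Polynomial.isLocalization _ _
    have hdisj : Disjoint (M : Set D[X]) (Q : Set D[X]) := by
      rw [Set.disjoint_left]
      rintro _ ⟨d, hd, rfl⟩ hdQ
      exact nonZeroDivisors.ne_zero hd (Ideal.mem_bot.1 (hc ▸ Ideal.mem_comap.2 hdQ))
    have := IsLocalization.isPrime_of_isPrime_disjoint M K[X] Q ‹_› hdisj
    rw [← IsLocalization.height_map_of_disjoint (S := K[X]) M Q hdisj]
    exact Ideal.height_le_one_of_isPrincipal_of_mem_minimalPrimes (Q.map (algebraMap D[X] K[X])) _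
      (by rw [Ideal.minimalPrimes_eq_subsingleton_self, Set.mem_singleton_iff])
  · rwa [Order.one_le_iff_ne_zero, Ne, Ideal.height_eq_zero_iff,
      IsDomain.minimalPrimes_eq_singleton_bot]

theorem toENat_trdeg_add_height_ker {D E : Type*} [CommRing D] [IsDomain D] [IsNoetherianRing D]
    [CommRing E] [IsDomain E] [Algebra D E] [FaithfulSMul D E] {g : D[X] →ₐ[D] E}
    (hg : Function.Surjective g) :
    Cardinal.toENat (Algebra.trdeg D E) + (RingHom.ker g).height = 1 := by
  by_cases h : RingHom.ker g = ⊥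
  · have htrdeg := (AlgEquiv.ofBijective g
      ⟨(RingHom.injective_iff_ker_eq_bot g).2 h, hg⟩).lift_trdeg_eq
    rw [Polynomial.trdeg_of_isDomain, Cardinal.lift_one] at htrdeg
    rw [h, Ideal.height_bot, add_zero, ← Cardinal.toENat_lift, ← htrdeg, map_one]
  · have : (RingHom.ker g).IsPrime := RingHom.ker_isPrime g
    have halg : Algebra.IsAlgebraic D E := by
      obtain ⟨f, hf, hf0⟩ := Submodule.exists_mem_ne_zero_of_ne_bot h
      have hX : IsAlgebraic D (g X) :=
        ⟨f, hf0, by rw [aeval_algHom_apply, aeval_X_left_apply]; exact hf⟩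
      refine ⟨hg.forall.2 fun y ↦ ?_⟩
      rw [← aeval_X_left_apply y, ← aeval_algHom_apply]
      exact Algebra.isAlgebraic_adjoin_singleton_iff.2 hX _ (aeval_mem_adjoin_singleton D _)
    have hC : (RingHom.ker g).comap C = ⊥ := by
      rw [eq_bot_iff]
      intro d (hd : g (C d) = 0)
      rw [← algebraMap_eq, AlgHom.commutes] at hd
      exact (map_eq_zero_iff _ (FaithfulSMul.algebraMap_injective D E)).1 hd
    rw [trdeg_eq_zero, map_zero, zero_add, height_eq_one_of_comap_C_eq_bot h hC]

theorem toENat_trdeg_quotient_comap {A B C : Type*} [CommRing A] [CommRing B] [CommRing C]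
    [Algebra A B] [Algebra A C] {f : B →ₐ[A] C} (hf : Function.Surjective f) {p : Ideal A}
    {P : Ideal B} {Q : Ideal C} [P.LiesOver p] [Q.LiesOver p] (hP : P = Q.comap f) :
    Cardinal.toENat (Algebra.trdeg (A ⧸ p) (B ⧸ P)) =
      Cardinal.toENat (Algebra.trdeg (A ⧸ p) (C ⧸ Q)) := by
  let φ : (B ⧸ P) →ₐ[A ⧸ p] (C ⧸ Q) :=
    { Ideal.quotientMap Q (f : B →+* C) hP.le with
      commutes' := Ideal.Quotient.mk_surjective.forall.2 fun a ↦
        congrArg (Ideal.Quotient.mk Q) (f.commutes a) }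
  have hφ : Function.Bijective φ :=
    ⟨Ideal.quotientMap_injective' (f := (f : B →+* C)) (H := hP.le) hP.ge,
      Ideal.quotientMap_surjective (f := (f : B →+* C)) (H := hP.le) hf⟩
  simpa only [Cardinal.toENat_lift] using
    congrArg Cardinal.toENat (AlgEquiv.ofBijective φ hφ).lift_trdeg_eq

/-- The dimension formula `trdeg κ(P) / κ(p) + ht P = ht p + N` for the primes `P` of an
`A`-algebra `R` of relative dimension `N` and `p = P ∩ A`. Transcendence degrees are those of the
domains `A ⧸ p ⊆ R ⧸ P`, truncated to `ℕ∞`. -/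
def SatisfiesDimensionFormula (A R : Type*) [CommRing A] [CommRing R] [Algebra A R] (N : ℕ) :
    Prop :=
  ∀ (P : Ideal R) [P.IsPrime] (p : Ideal A) [P.LiesOver p],
    Cardinal.toENat (Algebra.trdeg (A ⧸ p) (R ⧸ P)) + P.height = p.height + N

theorem SatisfiesDimensionFormula.of_algEquiv {A R S : Type*} [CommRing A] [CommRing R]
    [Algebra A R] [CommRing S] [Algebra A S] {N : ℕ} (h : SatisfiesDimensionFormula A R N)
    (e : R ≃ₐ[A] S) : SatisfiesDimensionFormula A S N := by
  intro P _ p _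
  have hheight : (P.comap e).height = P.height := e.toRingEquiv.height_comap P
  have hdim := h (P.comap e) p
  rwa [toENat_trdeg_quotient_comap (f := (e : R →ₐ[A] S)) e.surjective (P := P.comap e) (Q := P)
    rfl, hheight] at hdim

theorem satisfiesDimensionFormula_self (A : Type*) [CommRing A] :
    SatisfiesDimensionFormula A A 0 := by
  intro P _ p hp
  have : Algebra.IsIntegral (A ⧸ p) (A ⧸ P) := Algebra.isIntegral_of_surjective
    (Ideal.Quotient.mk_surjective.forall.2 fun a ↦ ⟨Ideal.Quotient.mk p a, rfl⟩)
  have := Ideal.isPrime_of_liesOver P p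
  have : Algebra.IsAlgebraic (A ⧸ p) (A ⧸ P) := inferInstance
  rw [trdeg_eq_zero, map_zero, zero_add, Nat.cast_zero, add_zero, hp.over]
  rfl

section Polynomial

variable {R : Type*} [CommRing R] (P : Ideal R[X]) (q : Ideal R) [P.LiesOver q]

theorem aeval_mk_X_map (f : R[X]) :
    aeval (R := R ⧸ q) (Ideal.Quotient.mk P X) (f.map (Ideal.Quotient.mk q)) =
      Ideal.Quotient.mk P f := by
  rw [← Ideal.Quotient.algebraMap_eq q, aeval_map_algebraMap, ← Ideal.Quotient.mkₐ_eq_mk R,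
    aeval_algHom_apply, aeval_X_left_apply]

theorem aeval_mk_X_surjective :
    Function.Surjective (aeval (R := R ⧸ q) (Ideal.Quotient.mk P X)) :=
  Ideal.Quotient.mk_surjective.forall.2 fun f ↦ ⟨_, aeval_mk_X_map P q f⟩

theorem ker_aeval_mk_X :
    RingHom.ker (aeval (R := R ⧸ q) (Ideal.Quotient.mk P X)) =
      P.map (mapRingHom (Ideal.Quotient.mk q)) := by
  have hmap := Polynomial.map_surjective _ (Ideal.Quotient.mk_surjective (I := q))
  have hmem (f : R[X]) : aeval (R := R ⧸ q) (Ideal.Quotient.mk P X)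
      (f.map (Ideal.Quotient.mk q)) = 0 ↔ f ∈ P := by
    rw [aeval_mk_X_map, Ideal.Quotient.eq_zero_iff_mem]
  have hcomap : (RingHom.ker (aeval (R := R ⧸ q) (Ideal.Quotient.mk P X))).comap
      (mapRingHom (Ideal.Quotient.mk q)) = P := Ideal.ext hmem
  conv_rhs => rw [← hcomap]
  exact (Ideal.map_comap_of_surjective _ hmap _).symm

theorem height_eq_height_add_height_map_mapRingHom [IsNoetherianRing R] [P.IsPrime] [q.IsPrime] :
    P.height = q.height + (P.map (mapRingHom (Ideal.Quotient.mk q))).height := by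
  let e : (R[X] ⧸ q.map (algebraMap R R[X])) ≃+* (R ⧸ q)[X] :=
    (Ideal.polynomialQuotientEquivQuotientPolynomial q).symm
  have he : (e : (R[X] ⧸ q.map (algebraMap R R[X])) →+* (R ⧸ q)[X]).comp
      (Ideal.Quotient.mk (q.map (algebraMap R R[X]))) = mapRingHom (Ideal.Quotient.mk q) := by
    ext x : 2 <;> simp [e]
  rw [Ideal.height_eq_height_add_of_liesOver_of_hasGoingDown q P, ← he, ← Ideal.map_map]
  exact congrArg (q.height + ·) (e.height_map _).symm

end Polynomial

theorem SatisfiesDimensionFormula.polynomial {A R : Type*} [CommRing A] [CommRing R] [Algebra A R]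
    [IsNoetherianRing R] {N : ℕ} (h : SatisfiesDimensionFormula A R N) :
    SatisfiesDimensionFormula A R[X] (N + 1) := by
  intro P _ p _
  let q := P.under R
  have := Ideal.isPrime_of_liesOver P p
  have : IsScalarTower (A ⧸ p) (R ⧸ q) (R[X] ⧸ P) := .of_algebraMap_eq <|
    Ideal.Quotient.mk_surjective.forall.2 fun a ↦
      congrArg (Ideal.Quotient.mk P) (IsScalarTower.algebraMap_apply A R R[X] a)
  have hfiber := toENat_trdeg_add_height_ker (aeval_mk_X_surjective P q)
  rw [ker_aeval_mk_X] at hfiber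
  rw [← trdeg_add_eq (A ⧸ p) (R ⧸ q) (A := R[X] ⧸ P), map_add,
    height_eq_height_add_height_map_mapRingHom P q, add_add_add_comm, h q p, hfiber,
    Nat.cast_add, Nat.cast_one, add_assoc]

theorem satisfiesDimensionFormula_mvPolynomial (A : Type*) [CommRing A] [IsNoetherianRing A]
    (n : ℕ) : SatisfiesDimensionFormula A (MvPolynomial (Fin n) A) n := by
  induction n with
  | zero =>
    exact (satisfiesDimensionFormula_self A).of_algEquiv (MvPolynomial.isEmptyAlgEquiv A _).symm
  | succ n ih => exact ih.polynomial.of_algEquiv (MvPolynomial.finSuccEquiv A n).symm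

end DimensionFormula

section Equidimensional

variable {A : Type*} [CommRing A]

theorem ringKrullDim_quotient_add_height [IsLocalRing A] [Ring.DimensionLEOne A] (p : Ideal A)
    [p.IsPrime] : ringKrullDim (A ⧸ p) + (p.height : WithBot ℕ∞) = ringKrullDim A := by
  obtain rfl | hp := eq_or_ne p ⊥
  · rw [Ideal.height_bot, ringKrullDim_eq_of_ringEquiv (RingEquiv.quotientBot A),
      WithBot.coe_zero, add_zero]
  · have : p.IsMaximal := Ring.DimensionLEOne.maximalOfPrime hp inferInstance
    rw [ringKrullDim_eq_zero_of_isField ((Ideal.Quotient.maximal_ideal_iff_isField_quotient p).1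
      this), zero_add, IsLocalRing.eq_maximalIdeal this,
      IsLocalRing.maximalIdeal_height_eq_ringKrullDim]

variable {R : Type*} [CommRing R] [Algebra A R] {N : ℕ} {I : Ideal R}

theorem componentDim_add_height [IsLocalRing A] [Ring.DimensionLEOne A]
    (hR : SatisfiesDimensionFormula A R N) (P : Ideal (R ⧸ I)) [P.IsPrime] :
    componentDim A P + ((P.comap (Ideal.Quotient.mk I)).height : WithBot ℕ∞) =
      ringKrullDim A + N := by
  let p := P.under A
  have : (P.comap (Ideal.Quotient.mk I)).LiesOver p := ⟨rfl⟩
  have htrdeg := toENat_trdeg_quotient_comap (p := p) (Q := P) (Ideal.Quotient.mkₐ_surjective A I)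
    (P := P.comap (Ideal.Quotient.mk I)) rfl
  rw [componentDim, add_assoc, ← WithBot.coe_add, ← htrdeg, hR, WithBot.coe_add, ← add_assoc,
    ringKrullDim_quotient_add_height, WithBot.coe_natCast]

theorem eq_of_add_eq_natCast {c : WithBot ℕ∞} {a b : ℕ∞} {n : ℕ} (ha : c + a = n)
    (hb : c + b = n) : a = b := by
  induction c with
  | bot => exact absurd ha (WithBot.bot_ne_coe (a := (n : ℕ∞)))
  | coe c =>
    norm_cast at ha hb
    refine WithTop.add_left_cancel ?_ (ha.trans hb.symm)
    rintro rfl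
    exact ENat.top_ne_natCast n ((top_add a).symm.trans ha)

theorem height_eq_of_mem_minimalPrimes_of_isEquidimensionalOver [IsDomain A]
    [IsDiscreteValuationRing A] (hR : SatisfiesDimensionFormula A R N)
    (hI : IsEquidimensionalOver A (R ⧸ I)) {P : Ideal R} (hP : P ∈ I.minimalPrimes) :
    P.height = I.height := by
  have hheight : ∀ Q ∈ I.minimalPrimes, Q.height = P.height := by
    rw [Ideal.minimalPrimes_eq_comap] at hP ⊢
    obtain ⟨P, hP, rfl⟩ := hP
    rintro _ ⟨Q, hQ, rfl⟩
    have := hP.isPrime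
    have := hQ.isPrime
    have hdim : ringKrullDim A + N = ((1 + N : ℕ) : WithBot ℕ∞) := by
      rw [IsDiscreteValuationRing.ringKrullDim_eq_one, Nat.cast_add, Nat.cast_one]
    refine eq_of_add_eq_natCast ((componentDim_add_height hR Q).trans hdim) ?_
    rw [hI Q hQ P hP, componentDim_add_height hR P, hdim]
  rw [I.height_eq_inf_minimalPrimes]
  exact le_antisymm (le_iInf₂ fun Q hQ ↦ (hheight Q hQ).ge) (iInf₂_le P hP)

end Equidimensional

theorem proposition3p1_general {A R : Type*} [CommRing A] [IsDomain A] [IsDiscreteValuationRing A]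
    [CommRing R] [IsRegularRing R] [Algebra A R] {τ : A} (hτ : Irreducible τ) {I : Ideal R}
    {rs : List R} (hrs : IsWeaklyRegular R rs) (hlen : (rs.length : ℕ∞) = I.height)
    (hJI : Ideal.ofList rs ≤ I) (hht : ∀ P ∈ I.minimalPrimes, P.height = I.height) :
    (HasNoEmbeddedComponents (R ⧸ I) ↔
      (Ideal.ofList rs).colon ((Ideal.ofList rs).colon (I : Set R) : Set R) ≤ I) ∧
    (Module.Flat A (R ⧸ I) ↔ I.colon {algebraMap A R τ} ≤ I) ∧
    (IsInternallyFlat A (R ⧸ I) ↔ I.colon {algebraMap A R τ} ⊓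
      (Ideal.ofList rs).colon ((Ideal.ofList rs).colon (I : Set R) : Set R) ≤ I) :=
  ⟨hasNoEmbeddedComponents_quotient_iff_colon_colon_le hrs hlen hJI hht,
    flat_quotient_iff_colon_le hτ,
    isInternallyFlat_quotient_iff_colon_inf_colon_colon_le hτ hrs hlen hJI hht⟩

theorem proposition3p1 {A : Type*} [CommRing A] [IsDomain A] [IsDiscreteValuationRing A]
    (τ : A) (hτ : Irreducible τ) (n : ℕ)
    (I J : Ideal (MvPolynomial (Fin n) A))
    (hI : IsEquidimensionalOver A (MvPolynomial (Fin n) A ⧸ I))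
    (hJI : J ≤ I)
    (rs : List (MvPolynomial (Fin n) A))
    (hrs : RingTheory.Sequence.IsRegular (MvPolynomial (Fin n) A) rs)
    (hJ : J = Ideal.ofList rs)
    (hlen : (rs.length : ℕ∞) = I.height) :
    (HasNoEmbeddedComponents (MvPolynomial (Fin n) A ⧸ I) ↔
      J.colon (J.colon (I : Set (MvPolynomial (Fin n) A)) : Set (MvPolynomial (Fin n) A)) ≤ I) ∧
    (Module.Flat A (MvPolynomial (Fin n) A ⧸ I) ↔
      I.colon {MvPolynomial.C τ} ≤ I) ∧
    (IsInternallyFlat A (MvPolynomial (Fin n) A ⧸ I) ↔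
      I.colon {MvPolynomial.C τ} ⊓
        J.colon (J.colon (I : Set (MvPolynomial (Fin n) A)) : Set (MvPolynomial (Fin n) A)) ≤ I) := by
  subst hJ
  exact proposition3p1_general hτ hrs.toIsWeaklyRegular hlen hJI fun P hP ↦
    height_eq_of_mem_minimalPrimes_of_isEquidimensionalOver
      (satisfiesDimensionFormula_mvPolynomial A n) hI hP
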